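/- Let $\sigma$ be the shift map on $\{0,1\}^{\mathbb N_0}$, $\sigma(s)_i=s_{i+1}$, and write $\mathbb N=\{1,2,3,\dots\}$. Define finite words by $C_0=10$ and, for $n\ge 1$, $$C_n=1^{8^n|C_0\cdots C_{n-1}|}\,0^{2^n|C_0\cdots C_{n-1}|},\qquad Q_n=0^{8^n|C_0\cdots C_{n-1}|}\,0^{2^n|C_0\cdots C_{n-1}|},$$ and, for $n\ge 0$, $W_n=W_0W_1\cdots W_{n-1}\,C_0C_1\cdots C_n\,Q_{n+1}$ (so $W_0=C_0Q_1$). Let $x=C_0C_1C_2\cdots$, $y=W_0W_1W_2\cdots$ and $$X=\overline{\{\sigma^n(x),\sigma^n(y): n\ge 0\}\cup\{0^nx,\,0^ny : n\in\mathbb N\}}\subseteq\{0,1\}^{\mathbb N_0}.$$ **Definitions.** Let $f$ be a continuous self-map of a compact metrizable space $X$ with compatible metric $d$ (the notions below do not depend on the choice of $d$). A pair $(a,b)\in X\times X$ is an *equicontinuity pair* if for every neighbourhood $O$ of $b$ there are neighbourhoods $U$ of $a$ and $V$ of $b$ such that for all $n\in\mathbb N$, $f^n(U)\cap V\ne\emptyset$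 implies $f^n(U)\subseteq O$. It is an *even continuity pair* if for every neighbourhood $O$ of $b$ there are neighbourhoods $U$ of $a$ and $V$ of $b$ such that for all $n\in\mathbb N$, $f^n(a)\in V$ implies $f^n(U)\subseteq O$; such a pair is *non-trivial* if $b\in\omega(a)$, the set of limit points of the sequence $(f^n(a))_n$. A point $a$ is a *point of even continuity* if $(a,b)$ is an even continuity pair for every $b\in X$. The system is *transitive* if for all nonempty open $U,V$ there is $n\in\mathbb N$ with $f^n(U)\cap V\neq\emptyset$; *sensitive* if there is $\delta>0$ such that every nonempty open $U$ contains points $a,b$ with $d(f^n(a),f^n(b))\ge\delta$ for some $n\in\mathbb N$; *Auslander–Yorke chaotic* if it is transitive and sensitive; *Devaney chaotic* if it is transitive and sensitive and its periodic points are dense. A pair $(a,b)$ is a *Li–Yorke pair* if $\liminf_n d(f^n(a),f^n(b))=0$ and $\limsup_n d(f^n(a),f^n(b))>0$; it is a *strong Li–Yorke pair* if moreover $(a,b)$ is recurrent for $f\times f$, i.e. $(a,b)\in\omega((a,b))$. The system is *densely Li–Yorke chaotic* if there is a dense uncountable set any two distinct points of which form a Li–Yorke pair, and *strongly Li–Yorke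 chaotic* if there is an uncountable set any two distinct points of which form a strong Li–Yorke pair. **Theorem.** The set $X$ is a compact subshift (closed and $\sigma(X)\subseteq X$), it contains $x$ and $0^\infty$, and the system $(X,\sigma)$ is transitive. The pair $(x,0^\infty)$ is a non-trivial even continuity pair of $(X,\sigma)$, but $(X,\sigma)$ has no point of even continuity and no equicontinuity pairs. Moreover $(X,\sigma)$ is Auslander–Yorke chaotic, densely Li–Yorke chaotic and strongly Li–Yorke chaotic, but not Devaney chaotic. -/

import Mathlib

open Filter Topology

namespace EvenCty

/-! ### Topological dynamics of a map `f : X → X`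

The letter `ℕ` in the quantifiers "for some / every iterate" ranges over the positive integers. -/

section Topological

variable {X : Type*} [TopologicalSpace X]

/-- `ω(x)`, the set of limit points of the forward orbit of `x`. -/
def omegaSet (f : X → X) (x : X) : Set X :=
  omegaLimit atTop (fun (n : ℕ) (z : X) => f^[n] z) {x}

/-- The point `x` is recurrent: `x ∈ ω(x)`. -/
def IsRecurrent (f : X → X) (x : X) : Prop :=
  x ∈ omegaSet f x

/-- (Topological) transitivity. -/
def IsTransitive (f : X → X) : Prop :=
  ∀ U V : Set X, IsOpen U → IsOpen V → U.Nonempty → V.Nonempty →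
    ∃ n : ℕ, 0 < n ∧ ((f^[n] '' U) ∩ V).Nonempty

/-- `(x, y)` is an equicontinuity pair. -/
def IsEquicontinuityPair (f : X → X) (x y : X) : Prop :=
  ∀ O ∈ 𝓝 y, ∃ U ∈ 𝓝 x, ∃ V ∈ 𝓝 y, ∀ n : ℕ, 0 < n →
    ((f^[n] '' U) ∩ V).Nonempty → f^[n] '' U ⊆ O

/-- `(x, y)` is an even continuity pair. -/
def IsEvenContinuityPair (f : X → X) (x y : X) : Prop :=
  ∀ O ∈ 𝓝 y, ∃ U ∈ 𝓝 x, ∃ V ∈ 𝓝 y, ∀ n : ℕ, 0 < n →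
    f^[n] x ∈ V → f^[n] '' U ⊆ O

/-- An even continuity pair `(x, y)` is non-trivial if `y ∈ ω(x)`; for `y ∉ ω(x)` the defining
condition holds automatically when `f` is continuous. -/
def IsNontrivialEvenContinuityPair (f : X → X) (x y : X) : Prop :=
  IsEvenContinuityPair f x y ∧ y ∈ omegaSet f x

/-- `x` is a point of even continuity: `(x, y)` is an even continuity pair for every `y`. -/
def IsEvenContinuityPoint (f : X → X) (x : X) : Prop :=
  ∀ y : X, IsEvenContinuityPair f x y

end Topological

/-! ### Sensitivity and chaos

These notions are written with entourages. On a metric space they are the usual notions for that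
metric; on a compact Hausdorff space the uniformity is unique, so there they are the usual notions
for every compatible metric. -/

section Uniform

variable {X : Type*} [UniformSpace X]

/-- Sensitivity: for some fixed entourage `D`, every nonempty open set contains two points
which some iterate takes `D`-apart. -/
def IsSensitive (f : X → X) : Prop :=
  ∃ D ∈ uniformity X, ∀ U : Set X, IsOpen U → U.Nonempty →
    ∃ x ∈ U, ∃ y ∈ U, ∃ n : ℕ, 0 < n ∧ (f^[n] x, f^[n] y) ∉ D

/-- Auslander–Yorke chaos: transitivity and sensitivity. -/
def IsAuslanderYorkeChaotic (f : X → X) : Prop :=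
  IsTransitive f ∧ IsSensitive f

/-- Devaney chaos: transitivity, sensitivity and density of the periodic points. -/
def IsDevaneyChaotic (f : X → X) : Prop :=
  IsTransitive f ∧ IsSensitive f ∧ Dense (Function.periodicPts f)

/-- Proximal pair: `liminf d(fⁿ x, fⁿ y) = 0`. -/
def IsProximalPair (f : X → X) (x y : X) : Prop :=
  ∀ D ∈ uniformity X, ∃ᶠ n : ℕ in atTop, (f^[n] x, f^[n] y) ∈ D

/-- Asymptotic pair: `lim d(fⁿ x, fⁿ y) = 0`. -/
def IsAsymptoticPair (f : X → X) (x y : X) : Prop :=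
  Tendsto (fun n : ℕ => (f^[n] x, f^[n] y)) atTop (uniformity X)

/-- Li–Yorke pair: `liminf d(fⁿ x, fⁿ y) = 0` and `limsup d(fⁿ x, fⁿ y) > 0`. -/
def IsLiYorkePair (f : X → X) (x y : X) : Prop :=
  IsProximalPair f x y ∧ ¬ IsAsymptoticPair f x y

/-- Strong Li–Yorke pair: a Li–Yorke pair which is a recurrent point of the product system. -/
def IsStrongLiYorkePair (f : X → X) (x y : X) : Prop :=
  IsLiYorkePair f x y ∧ IsRecurrent (Prod.map f f) (x, y)

/-- Dense Li–Yorke chaos: there is a dense uncountable scrambled set. -/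
def IsDenselyLiYorkeChaotic (f : X → X) : Prop :=
  ∃ S : Set X, ¬ S.Countable ∧ Dense S ∧ S.Pairwise (IsLiYorkePair f)

/-- Strong Li–Yorke chaos: there is an uncountable strongly scrambled set. -/
def IsStronglyLiYorkeChaotic (f : X → X) : Prop :=
  ∃ S : Set X, ¬ S.Countable ∧ S.Pairwise (IsStrongLiYorkePair f)

end Uniform

/-! ### Symbolic dynamics over `{0, 1}`, with `false` for the symbol `0` and `true` for `1` -/

/-- The shift map `σ` on `{0,1}^ℕ`. -/
def shift (s : ℕ → Bool) : ℕ → Bool := fun i => s (i + 1)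

/-- A (one-sided) subshift: a closed shift-invariant set of sequences. -/
structure IsSubshift (S : Set (ℕ → Bool)) : Prop where
  isClosed : IsClosed S
  mapsTo : Set.MapsTo shift S S

/-- The shift map, as a self-map of a subshift. -/
def IsSubshift.map {S : Set (ℕ → Bool)} (h : IsSubshift S) : S → S :=
  h.mapsTo.restrict shift S S

/-- The constant sequence `0^∞`. -/
def zeroSeq : ℕ → Bool := fun _ => false

/-- The sequence `0ⁿ s`. -/
def zerosThen (n : ℕ) (s : ℕ → Bool) : ℕ → Bool :=
  fun i => if i < n then false else s (i - n)

/-- The infinite concatenation `w₀ w₁ w₂ …` of nonempty words. (If all words are nonempty, then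
`w₀ … wᵢ` has more than `i` letters, so the default value is never used.) -/
def infConcat (w : ℕ → List Bool) : ℕ → Bool :=
  fun i => ((List.range (i + 1)).flatMap w).getD i false

/-- The `n`-th word `Cₙ`, given the word `p = C₀ … Cₙ₋₁`:
`C₀ = 10` and `Cₙ = 1^(8ⁿ|p|) 0^(2ⁿ|p|)` for `n ≥ 1`. -/
def nextC : ℕ → List Bool → List Bool
  | 0, _ => [true, false]
  | n + 1, p => List.replicate (8 ^ (n + 1) * p.length) true ++
      List.replicate (2 ^ (n + 1) * p.length) false

/-- The word `C₀ C₁ … Cₙ₋₁`. -/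
def prefC : ℕ → List Bool
  | 0 => []
  | n + 1 => prefC n ++ nextC n (prefC n)

/-- The word `Cₙ`. -/
def wordC (n : ℕ) : List Bool := nextC n (prefC n)

/-- The word `Qₙ = 0^(8ⁿ|C₀ … Cₙ₋₁|) 0^(2ⁿ|C₀ … Cₙ₋₁|)` (used for `n ≥ 1`). -/
def wordQ (n : ℕ) : List Bool :=
  List.replicate (8 ^ n * (prefC n).length) false ++
    List.replicate (2 ^ n * (prefC n).length) false

/-- The word `W₀ W₁ … Wₙ₋₁`, where `Wₙ = W₀ W₁ … Wₙ₋₁ C₀ C₁ … Cₙ Qₙ₊₁`. -/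
def prefW : ℕ → List Bool
  | 0 => []
  | n + 1 => prefW n ++ (prefW n ++ prefC (n + 1) ++ wordQ (n + 1))

/-- The word `Wₙ = W₀ W₁ … Wₙ₋₁ C₀ C₁ … Cₙ Qₙ₊₁`. -/
def wordW (n : ℕ) : List Bool := prefW n ++ prefC (n + 1) ++ wordQ (n + 1)

/-- The point `x = C₀ C₁ C₂ …`. -/
def pointX : ℕ → Bool := infConcat wordC

/-- The point `y = W₀ W₁ W₂ …`. -/
def pointY : ℕ → Bool := infConcat wordW

/-- The closure of `Orb(x) ∪ Orb(y) ∪ {0ⁿx, 0ⁿy : n ≥ 1}` in `{0,1}^ℕ`. -/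
def exampleShift : Set (ℕ → Bool) :=
  closure ({s | ∃ n : ℕ, s = shift^[n] pointX} ∪ {s | ∃ n : ℕ, s = shift^[n] pointY} ∪
    {s | ∃ n : ℕ, 0 < n ∧ (s = zerosThen n pointX ∨ s = zerosThen n pointY)})

/-- `prefC n` is indeed the concatenation of the first `n` words `Cᵢ`. -/
theorem prefC_eq (n : ℕ) : prefC n = (List.range n).flatMap wordC := by
  induction n with
  | zero => rfl
  | succ k ih => rw [List.range_succ, List.flatMap_append, ← ih]; simp [prefC, wordC]

/-- `prefW n` is indeed the concatenation of the first `n` words `Wᵢ`. -/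
theorem prefW_eq (n : ℕ) : prefW n = (List.range n).flatMap wordW := by
  induction n with
  | zero => rfl
  | succ k ih => rw [List.range_succ, List.flatMap_append, ← ih]; simp [prefW, wordW]

end EvenCty

namespace EvenCty

open scoped Uniformity

/-! Put P = W₀ … Wₙ₋₁. Then W₀ … Wₙ is P P C₀ … Cₙ Qₙ₊₁, and C₀ … Cₙ Qₙ₊₁ is C₀ … Cₙ₊₁ with its last
run of ones erased. The points of X are the sequences whose prefixes all occur in y
(`mem_exampleShift_iff`), so everything reduces to following positions in y. A position c of P
reappears as c or |P| + c in the next word; a chain of such choices is a climb (`IsClimb`).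

Rigidity: each W₀ … Wₙ₋₁ ends in a run of zeros much longer than the rest of it, so for m above its
base level every climb reads 0 on the interval [5|C₀ … Cₘ₋₁|, |C₀ … Cₘ|) (`IsClimb.pointY_false`),
which contains the zeros of Cₘ. As 101 occurs in y only at the start of some C₀ … Cₖ₋₁ Qₖ, points
starting with 101 vanish wherever x does (`eq_false_of_start`). This gives even continuity at (x,
0^∞), and excludes periodic points near x, since x has arbitrarily long runs of zeros.

Flexibility: suitable copies of one word are followed, at the same delay, by an arbitrary word of y
and by a block of ones (`exists_word_and_ones`); this gives sensitivity and excludes equicontinuity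
pairs. Other copies see y and x at the same delay, and y vanishes where x has a descent 10, so a
descent can be avoided at any late time (`exists_avoid_descent`). Hence no point of even continuity
exists. Finally, climbs coded by binary sequences have common long zero intervals (proximality),
common returns when both stay in the first copy (recurrence), and separate whenever their positions
differ. -/

/-- The length of `C₀ … Cₙ₋₁`. -/
def lenC (n : ℕ) : ℕ := (prefC n).length

/-- The length of `W₀ … Wₙ₋₁`. -/
def lenW (n : ℕ) : ℕ := (prefW n).length

/-! ### Lengths of the words and their growth -/

theorem lenC_zero : lenC 0 = 0 := rfl

theorem lenC_one : lenC 1 = 2 := rfl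

theorem lenC_succ {n : ℕ} (hn : 1 ≤ n) :
    lenC (n + 1) = lenC n + (8 ^ n * lenC n + 2 ^ n * lenC n) := by
  obtain ⟨k, rfl⟩ := Nat.exists_eq_add_of_le' hn
  rw [lenC, prefC, List.length_append, nextC, List.length_append, List.length_replicate,
    List.length_replicate]
  rfl

theorem lenW_zero : lenW 0 = 0 := rfl

/-- Qₙ₊₁ is exactly as long as Cₙ₊₁, which is what makes C₀ … Cₙ Qₙ₊₁ comparable with x letter by
letter. -/
theorem lenC_add_wordQ (n : ℕ) : lenC (n + 1) + (wordQ (n + 1)).length = lenC (n + 2) := by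
  rw [lenC_succ (n := n + 1) (by omega), wordQ]
  simp [lenC]

theorem lenW_succ (n : ℕ) : lenW (n + 1) = 2 * lenW n + lenC (n + 2) := by
  rw [lenW, prefW, ← lenC_add_wordQ]
  simp only [List.length_append, lenW, lenC]
  omega

/-- The worst case is n = 1, with factor 1 + 8 + 2 = 11. -/
theorem lenC_growth {n : ℕ} (hn : 1 ≤ n) :
    9 * lenC n + 2 * lenC n ≤ lenC (n + 1) := by
  rw [lenC_succ hn]
  have h8 : 8 ^ 1 ≤ 8 ^ n := Nat.pow_le_pow_right (by norm_num) hn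
  have h2 : 2 ^ 1 ≤ 2 ^ n := Nat.pow_le_pow_right (by norm_num) hn
  have := Nat.mul_le_mul_right (lenC n) h8
  have := Nat.mul_le_mul_right (lenC n) h2
  omega

theorem lenC_lt_succ (n : ℕ) : lenC n < lenC (n + 1) := by
  induction n with
  | zero => rw [lenC_zero, lenC_one]; norm_num
  | succ k ih =>
    have := lenC_growth (n := k + 1) (by omega)
    omega

theorem lenC_strictMono : StrictMono lenC := strictMono_nat_of_lt_succ lenC_lt_succ

theorem two_le_lenC {n : ℕ} (hn : 1 ≤ n) : 2 ≤ lenC n :=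
  lenC_one ▸ lenC_strictMono.monotone hn

theorem lenC_le_lenW {n : ℕ} (hn : 1 ≤ n) : lenC (n + 1) ≤ lenW n := by
  obtain ⟨k, rfl⟩ := Nat.exists_eq_add_of_le' hn
  exact lenW_succ k ▸ Nat.le_add_left _ _

/-- The doublings in W₀ … Wₙ₋₁ are absorbed by the growth of `lenC`. Hence `2 * lenW n` is at most
4|C₀ … Cₙ|, short compared with the run of ones in Cₙ₊₁. -/
theorem lenW_le (n : ℕ) : lenW n ≤ 2 * lenC (n + 1) := by
  induction n with
  | zero => simp [lenW_zero]
  | succ k ih =>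
    have h : 9 * lenC (k + 1) + 2 * lenC (k + 1) ≤ lenC (k + 2) := lenC_growth (by omega)
    rw [lenW_succ, show k + 1 + 1 = k + 2 from rfl]
    omega

theorem lenW_strictMono : StrictMono lenW := by
  refine strictMono_nat_of_lt_succ fun n => ?_
  rw [lenW_succ]
  have := two_le_lenC (n := n + 2) (by omega)
  omega

/-! ### Letters of x and y -/

theorem flatMap_range_prefix (w : ℕ → List Bool) {m n : ℕ} (h : m ≤ n) :
    (List.range m).flatMap w <+: (List.range n).flatMap w := by
  induction n, h using Nat.le_induction with
  | base => exact List.prefix_rfl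
  | succ k _ ih =>
    rw [List.range_succ, List.flatMap_append]
    exact ih.trans (List.prefix_append _ _)

theorem getD_of_prefix {l l' : List Bool} (h : l <+: l') {i : ℕ} (hi : i < l.length) :
    l'.getD i false = l.getD i false := by
  obtain ⟨t, rfl⟩ := h
  exact List.getD_append _ _ _ _ hi

theorem le_length_flatMap_range {w : ℕ → List Bool} (hw : ∀ n, w n ≠ []) (n : ℕ) :
    n ≤ ((List.range n).flatMap w).length := by
  induction n with
  | zero => simp
  | succ k ih =>
    rw [List.range_succ, List.flatMap_append, List.length_append]
    have := List.length_pos_of_ne_nil (hw k)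
    simp only [List.flatMap_cons, List.flatMap_nil, List.append_nil]
    omega

theorem infConcat_eq {w : ℕ → List Bool} (hw : ∀ n, w n ≠ []) {n i : ℕ}
    (hi : i < ((List.range n).flatMap w).length) :
    infConcat w i = ((List.range n).flatMap w).getD i false := by
  rw [infConcat]
  rcases le_total (i + 1) n with h | h
  · exact (getD_of_prefix (flatMap_range_prefix w h) (le_length_flatMap_range hw (i + 1))).symm
  · exact getD_of_prefix (flatMap_range_prefix w h) hi

theorem wordC_ne_nil (n : ℕ) : wordC n ≠ [] := by
  intro h
  have h1 := lenC_lt_succ n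
  have h2 : lenC (n + 1) = lenC n + (wordC n).length := by
    simp only [lenC, prefC, wordC, List.length_append]
  rw [h] at h2
  simp at h2
  omega

theorem wordW_ne_nil (n : ℕ) : wordW n ≠ [] := by
  intro h
  have h1 : lenW n < lenW (n + 1) := lenW_strictMono (Nat.lt_succ_self n)
  have h2 : lenW (n + 1) = lenW n + (wordW n).length := by
    simp only [lenW, prefW, wordW, List.length_append]
  rw [h] at h2
  simp at h2
  omega

theorem pointX_eq {n i : ℕ} (hi : i < lenC n) : pointX i = (prefC n).getD i false := by
  rw [lenC] at hi
  rw [prefC_eq] at hi ⊢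
  exact infConcat_eq wordC_ne_nil hi

theorem pointY_eq {n i : ℕ} (hi : i < lenW n) : pointY i = (prefW n).getD i false := by
  rw [lenW] at hi
  rw [prefW_eq] at hi ⊢
  exact infConcat_eq wordW_ne_nil hi

theorem getD_replicate_false (n i : ℕ) : (List.replicate n false).getD i false = false := by
  rw [List.getD_eq_getElem?_getD, List.getElem?_replicate]
  split <;> rfl

theorem pointX_zero : pointX 0 = true := rfl

theorem pointX_one : pointX 1 = false := rfl

theorem pointX_true {n t : ℕ} (hn : 1 ≤ n) (h1 : lenC n ≤ t)
    (h2 : t < lenC n + 8 ^ n * lenC n) : pointX t = true := by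
  have h3 := lenC_succ hn
  rw [pointX_eq (n := n + 1) (by omega), prefC]
  obtain ⟨k, rfl⟩ := Nat.exists_eq_add_of_le' hn
  rw [List.getD_append_right _ _ _ _ h1, nextC, List.getD_append _ _ _ _ (by
    rw [List.length_replicate]; simp only [lenC] at *; omega), List.getD_eq_getElem?_getD,
    List.getElem?_replicate_of_lt (by simp only [lenC] at *; omega)]
  rfl

theorem pointX_false {n t : ℕ} (hn : 1 ≤ n) (h1 : lenC n + 8 ^ n * lenC n ≤ t)
    (h2 : t < lenC (n + 1)) : pointX t = false := by
  rw [pointX_eq (n := n + 1) (by omega), prefC]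
  obtain ⟨k, rfl⟩ := Nat.exists_eq_add_of_le' hn
  rw [List.getD_append_right _ _ _ _ (by simp only [lenC] at *; omega), nextC,
    List.getD_append_right _ _ _ _ (by rw [List.length_replicate]; simp only [lenC] at *; omega),
    getD_replicate_false]

/-- The words `W₀ … Wₙ₋₁` occur twice at the start of `y`. -/
theorem pointY_lenW_add {n t : ℕ} (ht : t < lenW n) : pointY (lenW n + t) = pointY t := by
  have h := lenW_succ n
  rw [pointY_eq (n := n + 1) (by omega), pointY_eq ht, prefW,
    List.getD_append_right _ _ _ _ (by rw [lenW]; omega), List.append_assoc,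
    List.getD_append _ _ _ _ (by simp only [lenW] at *; omega)]
  congr 1
  simp only [lenW]; omega

theorem pointY_two_lenW_add {n t : ℕ} (ht : t < lenC (n + 1)) :
    pointY (2 * lenW n + t) = pointX t := by
  have h := lenW_succ n
  have h' : lenC (n + 1) < lenC (n + 2) := lenC_lt_succ (n + 1)
  rw [pointY_eq (n := n + 1) (by omega), pointX_eq ht, prefW,
    List.getD_append_right _ _ _ _ (by simp only [lenW]; omega), List.append_assoc,
    List.getD_append_right _ _ _ _ (by simp only [lenW]; omega),
    List.getD_append _ _ _ _ (by simp only [lenW, lenC] at *; omega)]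
  congr 1
  simp only [lenW]; omega

theorem pointY_two_lenW_add_false {n t : ℕ} (ht : lenC (n + 1) ≤ t) (ht' : t < lenC (n + 2)) :
    pointY (2 * lenW n + t) = false := by
  have h := lenW_succ n
  rw [pointY_eq (n := n + 1) (by omega), prefW,
    List.getD_append_right _ _ _ _ (by simp only [lenW]; omega), List.append_assoc,
    List.getD_append_right _ _ _ _ (by simp only [lenW]; omega),
    List.getD_append_right _ _ _ _ (by simp only [lenW, lenC] at *; omega),
    wordQ, ← List.replicate_add, getD_replicate_false]

theorem exists_level {t : ℕ} (ht : 1 ≤ t) (hx : pointX t = true) :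
    ∃ n, 1 ≤ n ∧ lenC n ≤ t ∧ t < lenC n + 8 ^ n * lenC n := by
  have hex : ∃ n, t < lenC n := ⟨t + 1, (Nat.lt_succ_self t).trans_le lenC_strictMono.le_apply⟩
  obtain ⟨n, hn⟩ : ∃ n, Nat.find hex = n + 1 := by
    refine Nat.exists_eq_succ_of_ne_zero fun h0 => ?_
    have := Nat.find_spec hex
    rw [h0, lenC_zero] at this
    omega
  have h1 : t < lenC (n + 1) := hn ▸ Nat.find_spec hex
  have h2 : lenC n ≤ t := not_lt.1 (Nat.find_min hex (m := n) (by omega))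
  have h3 : 1 ≤ n := by
    by_contra h
    obtain rfl : n = 0 := by omega
    rw [zero_add, lenC_one] at h1
    obtain rfl : t = 1 := by omega
    exact absurd hx (by rw [pointX_one]; simp)
  refine ⟨n, h3, h2, ?_⟩
  by_contra h
  rw [pointX_false h3 (by omega) h1] at hx
  exact absurd hx (by simp)

/-- A descent `10` of `x` away from the origin is the end of the run of ones of some `Cₙ`. -/
theorem exists_level_of_descent {t : ℕ} (ht : 1 ≤ t) (hx : pointX t = true)
    (hx' : pointX (t + 1) = false) : ∃ n, 1 ≤ n ∧ t + 1 = lenC n + 8 ^ n * lenC n := by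
  obtain ⟨n, hn, h1, h2⟩ := exists_level ht hx
  refine ⟨n, hn, ?_⟩
  by_contra h
  rw [pointX_true hn (by omega) (by omega)] at hx'
  exact absurd hx' (by simp)

theorem eight_mul_le {n : ℕ} (hn : 1 ≤ n) : 8 * lenC n ≤ 8 ^ n * lenC n :=
  Nat.mul_le_mul_right _ (by simpa using Nat.pow_le_pow_right (n := 8) (by norm_num) hn)

theorem four_le_two_pow_mul {n : ℕ} (hn : 1 ≤ n) : 4 ≤ 2 ^ n * lenC n :=
  Nat.mul_le_mul (Nat.le_self_pow (by omega) 2) (two_le_lenC hn)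

/-- `y` vanishes at the descents of `x`. -/
theorem pointY_false_of_descent {t : ℕ} (ht : 1 ≤ t) (hx : pointX t = true)
    (hx' : pointX (t + 1) = false) : pointY t = false := by
  obtain ⟨n, hn, h⟩ := exists_level_of_descent ht hx hx'
  obtain ⟨k, rfl⟩ := Nat.exists_eq_add_of_le' hn
  have h1 := lenW_le k
  have h2 := eight_mul_le hn
  have h3 : lenC (k + 2) = _ := lenC_succ hn
  have h4 := two_le_lenC hn
  -- The descent lies near 9|C₀ … Cₖ| or beyond, while `2 * lenW k` is at most 4|C₀ … Cₖ|: the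
  -- position falls among the zeros of Qₖ₊₁.
  have := pointY_two_lenW_add_false (n := k) (t := t - 2 * lenW k) (by omega) (by omega)
  rwa [Nat.add_sub_cancel' (by omega)] at this

theorem pointX_pred_lenC {n : ℕ} (hn : 1 ≤ n) : pointX (lenC n - 1) = false := by
  obtain ⟨k, rfl⟩ := Nat.exists_eq_add_of_le' hn
  rcases Nat.eq_zero_or_pos k with rfl | hk
  · rfl
  · have h1 := lenC_succ hk
    have h2 := four_le_two_pow_mul hk
    exact pointX_false hk (by omega) (by omega)

theorem pointY_lenW {n : ℕ} (hn : 1 ≤ n) : pointY (lenW n) = true := by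
  have := lenW_strictMono hn
  exact pointY_lenW_add (n := n) (t := 0) (by omega)

theorem pointY_two_lenW (n : ℕ) : pointY (2 * lenW n) = true :=
  pointY_two_lenW_add (n := n) (t := 0) (by have := two_le_lenC (n := n + 1) (by omega); omega)

theorem pointY_one : pointY 1 = false := rfl

/-- The final zeros of `W₀ … Wₙ₋₁`. -/
theorem pointY_false {n t : ℕ} (hn : 1 ≤ n) (h1 : lenW n + lenC n ≤ t + lenC (n + 1))
    (h2 : t < lenW n) : pointY t = false := by
  obtain ⟨k, rfl⟩ := Nat.exists_eq_add_of_le' hn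
  have h := lenW_succ k
  have h' : lenC (k + 1) < lenC (k + 2) := lenC_lt_succ (k + 1)
  rw [show k + 1 + 1 = k + 2 from rfl] at h1
  have := pointY_two_lenW_add_false (n := k) (t := t - 2 * lenW k) (by omega) (by omega)
  rwa [Nat.add_sub_cancel' (by omega)] at this

/-! ### Cylinders and the description of the subshift -/

theorem hasBasis_uniformity_seq : (𝓤 (ℕ → Bool)).HasBasis (fun _ : ℕ => True)
    fun m => {q | ∀ t < m, q.1 t = q.2 t} := by
  rw [Pi.uniformity]
  simp only [DiscreteUniformity.eq_principal_setRelId, comap_principal]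
  refine (hasBasis_iInf_principal_finite _).to_hasBasis (fun I hI => ?_) fun m _ => ?_
  · obtain ⟨m, hm⟩ := hI.bddAbove
    refine ⟨m + 1, trivial, fun q hq => ?_⟩
    simp only [Set.mem_iInter]
    exact fun i hi => hq i (Nat.lt_succ_of_le (hm hi))
  · refine ⟨Set.Iio m, Set.finite_Iio m, fun q hq => ?_⟩
    simp only [Set.mem_iInter] at hq
    exact fun t ht => hq t ht

theorem hasBasis_uniformity (S : Set (ℕ → Bool)) : (𝓤 S).HasBasis (fun _ : ℕ => True)
    fun m => {q | ∀ t < m, q.1.1 t = q.2.1 t} := by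
  rw [uniformity_subtype]
  exact hasBasis_uniformity_seq.comap _

theorem mem_uniformity_iff {S : Set (ℕ → Bool)} {D : Set (S × S)} :
    D ∈ 𝓤 S ↔ ∃ m, ∀ z z' : S, (∀ t < m, z.1 t = z'.1 t) → (z, z') ∈ D := by
  rw [(hasBasis_uniformity S).mem_iff]
  exact ⟨fun ⟨m, _, h⟩ => ⟨m, fun z z' hz => h hz⟩, fun ⟨m, h⟩ => ⟨m, trivial, fun q hq => h _ _ hq⟩⟩

theorem mem_nhds_subtype_iff {S : Set (ℕ → Bool)} {a : S} {U : Set S} :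
    U ∈ 𝓝 a ↔ ∃ m, ∀ z : S, (∀ t < m, z.1 t = a.1 t) → z ∈ U := by
  rw [(nhds_basis_uniformity' (hasBasis_uniformity S)).mem_iff]
  exact ⟨fun ⟨m, _, h⟩ => ⟨m, fun z hz => h fun t ht => (hz t ht).symm⟩,
    fun ⟨m, h⟩ => ⟨m, trivial, fun z hz => h z fun t ht => (hz t ht).symm⟩⟩

theorem mem_nhds_seq_iff {a : ℕ → Bool} {U : Set (ℕ → Bool)} :
    U ∈ 𝓝 a ↔ ∃ m, ∀ z, (∀ t < m, z t = a t) → z ∈ U := by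
  rw [(nhds_basis_uniformity' hasBasis_uniformity_seq).mem_iff]
  exact ⟨fun ⟨m, _, h⟩ => ⟨m, fun z hz => h fun t ht => (hz t ht).symm⟩,
    fun ⟨m, h⟩ => ⟨m, trivial, fun z hz => h z fun t ht => (hz t ht).symm⟩⟩

theorem shift_iterate (n : ℕ) (s : ℕ → Bool) (t : ℕ) : shift^[n] s t = s (n + t) := by
  induction n generalizing s with
  | zero => simp
  | succ k ih =>
    rw [Function.iterate_succ_apply, ih, shift]
    congr 1
    omega

theorem map_iterate {S : Set (ℕ → Bool)} (hS : IsSubshift S) (n : ℕ) (z : S) (t : ℕ) :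
    (hS.map^[n] z).1 t = z.1 (n + t) := by
  rw [← shift_iterate n z.1 t]
  induction n generalizing z with
  | zero => rfl
  | succ k ih => rw [Function.iterate_succ_apply, Function.iterate_succ_apply, ih]; rfl

theorem exists_lt_lenW (t : ℕ) : t < lenW (t + 1) :=
  (Nat.lt_succ_self t).trans_le lenW_strictMono.le_apply

/-- The subshift consists of the sequences all of whose prefixes occur in `y`. -/
theorem mem_exampleShift_iff {z : ℕ → Bool} :
    z ∈ exampleShift ↔ ∀ m, ∃ c, ∀ t < m, z t = pointY (c + t) := by
  constructor
  · intro hz m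
    obtain ⟨s, hs, hsA⟩ := mem_closure_iff_nhds.1 hz {s | ∀ t < m, s t = z t}
      (mem_nhds_seq_iff.2 ⟨m, fun _ h => h⟩)
    suffices h : ∃ c, ∀ t < m, s t = pointY (c + t) by
      obtain ⟨c, hc⟩ := h
      exact ⟨c, fun t ht => (hs t ht).symm.trans (hc t ht)⟩
    rcases hsA with (⟨n, rfl⟩ | ⟨n, rfl⟩) | ⟨n, hn, rfl | rfl⟩
    · refine ⟨2 * lenW (n + m) + n, fun t ht => ?_⟩
      rw [shift_iterate, add_assoc, pointY_two_lenW_add]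
      exact (by omega : n + t < n + m + 1).trans_le lenC_strictMono.le_apply
    · exact ⟨n, fun t _ => shift_iterate n _ t⟩
    · set K := n + m + 1 with hK
      have h0 : K ≤ lenC K := lenC_strictMono.le_apply
      have h1 := lenC_le_lenW (n := K) (by omega)
      have h2 := lenC_growth (n := K) (by omega)
      -- At `2 * lenW K` a long prefix of x follows the final zeros of the second copy of W₀ …
      -- W_{K-1}.
      refine ⟨2 * lenW K - n, fun t ht => ?_⟩
      rw [zerosThen]
      split
      · rw [show 2 * lenW K - n + t = lenW K + (lenW K - n + t) by omega,
          pointY_lenW_add (by omega), pointY_false (n := K) (by omega) (by omega) (by omega)]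
      · rw [show 2 * lenW K - n + t = 2 * lenW K + (t - n) by omega,
          pointY_two_lenW_add (by omega)]
    · set K := n + m + 1 with hK
      have h0 : K ≤ lenC K := lenC_strictMono.le_apply
      have h1 := lenC_le_lenW (n := K) (by omega)
      have h2 := lenC_growth (n := K) (by omega)
      refine ⟨lenW K - n, fun t ht => ?_⟩
      rw [zerosThen]
      split
      · rw [pointY_false (n := K) (by omega) (by omega) (by omega)]
      · rw [show lenW K - n + t = lenW K + (t - n) by omega, pointY_lenW_add (by omega)]
  · intro h
    refine mem_closure_iff_nhds.2 fun U hU => ?_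
    obtain ⟨m, hm⟩ := mem_nhds_seq_iff.1 hU
    obtain ⟨c, hc⟩ := h m
    exact ⟨shift^[c] pointY, hm _ fun t ht => by rw [shift_iterate, hc t ht],
      Or.inl (Or.inr ⟨c, rfl⟩)⟩

theorem isSubshift_exampleShift : IsSubshift exampleShift where
  isClosed := isClosed_closure
  mapsTo z hz := by
    rw [mem_exampleShift_iff] at hz ⊢
    intro m
    obtain ⟨c, hc⟩ := hz (m + 1)
    refine ⟨c + 1, fun t ht => ?_⟩
    rw [shift, hc _ (by omega)]
    congr 1
    omega

/-- The point `σᶜ(y)` of the subshift. -/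
def orbitY (c : ℕ) : exampleShift :=
  ⟨fun t => pointY (c + t), mem_exampleShift_iff.2 fun _ => ⟨c, fun _ _ => rfl⟩⟩

theorem pointX_mem : pointX ∈ exampleShift :=
  subset_closure (Or.inl (Or.inl ⟨0, rfl⟩))

theorem zeroSeq_mem : zeroSeq ∈ exampleShift := by
  refine mem_exampleShift_iff.2 fun m => ?_
  have h0 : m + 1 ≤ lenC (m + 1) := lenC_strictMono.le_apply
  have h2 := lenC_growth (n := m + 1) (by omega)
  exact ⟨2 * lenW m + lenC (m + 1), fun t ht => by
    rw [add_assoc, pointY_two_lenW_add_false (by omega) (by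
      rw [show m + 2 = m + 1 + 1 from rfl]; omega)]; rfl⟩

/-! ### Climbing the hierarchy of the words `W₀ … Wₙ₋₁` -/

/-- A position `c` in `W₀ … Wₙ₋₁` corresponds to the positions `c` and `|W₀ … Wₙ₋₁| + c`
in `W₀ … Wₙ`: the remaining part of the smaller word is unchanged. -/
theorem pointY_climb {n c c' t : ℕ} (h : c' = c ∨ c' = lenW n + c) (ht : c + t < lenW n) :
    pointY (c' + t) = pointY (c + t) := by
  rcases h with rfl | rfl
  · rfl
  · rw [add_assoc, pointY_lenW_add ht]

/-- Positions in `y`, one for each of the words `W₀ … Wₙ₋₁` with `n ≥ J`, each obtained from the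
previous one by passing to one of the two copies of `W₀ … Wₙ₋₁` in `W₀ … Wₙ`. -/
structure IsClimb (J : ℕ) (c : ℕ → ℕ) : Prop where
  base : c J < lenW J
  step : ∀ n, J ≤ n → c (n + 1) = c n ∨ c (n + 1) = lenW n + c n

namespace IsClimb

variable {J : ℕ} {c : ℕ → ℕ}

theorem lt (h : IsClimb J c) {n : ℕ} (hn : J ≤ n) : c n < lenW n := by
  induction n, hn using Nat.le_induction with
  | base => exact h.base
  | succ k hk ih =>
    have := lenW_succ k
    rcases h.step k hk with h' | h' <;> omega

/-- Either choice leaves the closing block C₀ … Cₙ Qₙ₊₁, of length `lenC (n + 2)`, ahead of the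
position, after the part of the smaller word that was still to be read. -/
theorem add_lenC_le (h : IsClimb J c) {n : ℕ} (hn : J ≤ n) :
    c (n + 1) + lenC (n + 2) + (lenW n - c n) ≤ lenW (n + 1) := by
  have h1 := lenW_succ n
  have h2 := h.lt hn
  rcases h.step n hn with h' | h' <;> omega

theorem sub_mono (h : IsClimb J c) {m n : ℕ} (hm : J ≤ m) (hmn : m ≤ n) :
    lenW m - c m ≤ lenW n - c n := by
  induction n, hmn using Nat.le_induction with
  | base => exact le_rfl
  | succ k hk ih =>
    have := h.add_lenC_le (hm.trans hk)
    omega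

theorem lenC_le (h : IsClimb J c) {n : ℕ} (hn : J + 1 ≤ n) :
    c n + lenC (n + 1) ≤ lenW n := by
  obtain ⟨k, rfl⟩ := Nat.exists_eq_add_of_le' (show 1 ≤ n by omega)
  have := h.add_lenC_le (n := k) (by omega)
  rw [show k + 1 + 1 = k + 2 from rfl]
  omega

theorem pointY_eq (h : IsClimb J c) {m n t : ℕ} (hm : J ≤ m) (hmn : m ≤ n)
    (ht : c m + t < lenW m) : pointY (c n + t) = pointY (c m + t) := by
  induction n, hmn using Nat.le_induction with
  | base => rfl
  | succ k hk ih =>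
    rw [← ih]
    have := h.sub_mono hm hk
    have := h.lt (hm.trans hk)
    exact pointY_climb (h.step k (hm.trans hk)) (by omega)

end IsClimb

/-- The constant is 5 = 4 + 1: the two copies preceding the last block of W₀ … Wₙ₋₁ have total
length at most 4|C₀ … Cₙ₋₁|, and the nonzero letters of that block lie in its prefix C₀ … Cₙ₋₁. -/
theorem pointY_false_of_lenC_le {n c t : ℕ} (hn : 1 ≤ n) (hc : c + lenC (n + 1) ≤ lenW n)
    (h1 : 5 * lenC n ≤ t) (h2 : t < lenC (n + 1)) : pointY (c + t) = false := by
  obtain ⟨k, rfl⟩ := Nat.exists_eq_add_of_le' hn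
  have h3 := lenW_succ k
  have h4 := lenW_le k
  refine pointY_false hn ?_ (by omega)
  rw [h3]
  rw [show k + 1 + 1 = k + 2 from rfl] at *
  omega

theorem IsClimb.pointY_false {J : ℕ} {c : ℕ → ℕ} (h : IsClimb J c) {m n t : ℕ} (hm : J + 1 ≤ m)
    (hmn : m ≤ n) (h1 : 5 * lenC m ≤ t) (h2 : t < lenC (m + 1)) : pointY (c n + t) = false := by
  have h3 := h.lenC_le hm
  rw [h.pointY_eq (by omega) hmn (by omega)]
  exact pointY_false_of_lenC_le (by omega) h3 h1 h2

/-- Every position in `y` lies, for a unique `k ≥ 1`, in the part `C₀ … C_{k-1} Qₖ` of a copy of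
`W₀ … W_{k-1}`. -/
theorem exists_climb {n i : ℕ} (hi : i < lenW n) :
    ∃ k r c, 1 ≤ k ∧ k ≤ n ∧ r < lenC (k + 1) ∧ c k = 2 * lenW (k - 1) ∧ IsClimb k c ∧
      ∀ m, n ≤ m → c m + r = i := by
  induction n generalizing i with
  | zero => simp [lenW_zero] at hi
  | succ n ih =>
    have hs := lenW_succ n
    rcases lt_or_ge i (2 * lenW n) with h | h
    · obtain ⟨i', hi', h'⟩ : ∃ i' < lenW n, i = i' ∨ i = lenW n + i' := by
        rcases lt_or_ge i (lenW n) with h | h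
        · exact ⟨i, h, Or.inl rfl⟩
        · exact ⟨i - lenW n, by omega, by omega⟩
      obtain ⟨k, r, c, hk, hkn, hr, hc, hC, hm⟩ := ih hi'
      -- The choice of copy is made once, between levels n and n + 1; afterwards the climb is
      -- constant.
      refine ⟨k, r, fun m => if m ≤ n then c m else i - r, hk, by omega, hr, by simp [hkn, hc],
        ⟨by simpa [hkn] using hC.base, fun m hkm => ?_⟩, fun m hnm => ?_⟩
      · have := hm n le_rfl
        rcases lt_trichotomy m n with h1 | rfl | h1
        · rw [if_pos (by omega), if_pos (by omega)]
          exact hC.step m hkm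
        · rw [if_pos le_rfl, if_neg (by omega)]
          omega
        · rw [if_neg (by omega), if_neg (by omega)]
          exact Or.inl rfl
      · have := hm n le_rfl
        simp only [if_neg (show ¬ m ≤ n by omega)]
        omega
    · refine ⟨n + 1, i - 2 * lenW n, fun _ => 2 * lenW n, by omega, le_rfl, ?_, by simp,
        ⟨?_, fun _ _ => Or.inl rfl⟩, fun _ _ => Nat.add_sub_cancel' h⟩
      · rw [show n + 1 + 1 = n + 2 from rfl]; omega
      · have := two_le_lenC (n := n + 2) (by omega)
        omega

/-- A neighbourhood of a point of the subshift contains all the points starting with a suitable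
word of `y`. -/
theorem exists_word_of_mem_nhds {a : exampleShift} {U : Set exampleShift} (hU : U ∈ 𝓝 a)
    (l : ℕ) : ∃ i m, l ≤ m ∧ (∀ t < m, a.1 t = pointY (i + t)) ∧
      ∀ z : exampleShift, (∀ t < m, z.1 t = pointY (i + t)) → z ∈ U := by
  obtain ⟨m, hm⟩ := mem_nhds_subtype_iff.1 hU
  obtain ⟨i, hi⟩ := mem_exampleShift_iff.1 a.2 (m + l)
  exact ⟨i, m + l, by omega, hi, fun z hz => hm z fun t ht => by
    rw [hi t (by omega), hz t (by omega)]⟩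

/-- The shift map of the subshift. -/
abbrev exampleMap : exampleShift → exampleShift := isSubshift_exampleShift.map

theorem exampleMap_iterate (n : ℕ) (z : exampleShift) (t : ℕ) :
    (exampleMap^[n] z).1 t = z.1 (n + t) := map_iterate _ n z t

theorem mem_nhds_of_coord (a : exampleShift) (t : ℕ) :
    {z : exampleShift | z.1 t = a.1 t} ∈ 𝓝 a :=
  mem_nhds_subtype_iff.2 ⟨t + 1, fun _ hz => hz t (Nat.lt_succ_self t)⟩

/-! ### Transitivity, absence of equicontinuity pairs, sensitivity -/

theorem isTransitive_exampleMap : IsTransitive exampleMap := by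
  rintro U V hU hV ⟨a, ha⟩ ⟨b, hb⟩
  obtain ⟨i, m, -, -, hi⟩ := exists_word_of_mem_nhds (hU.mem_nhds ha) 0
  obtain ⟨j, l, -, -, hj⟩ := exists_word_of_mem_nhds (hV.mem_nhds hb) 0
  have hK := exists_lt_lenW (i + j + l)
  refine ⟨lenW (i + j + l + 1) + j - i, by omega, _, ⟨orbitY i, hi _ fun _ _ => rfl, rfl⟩,
    hj _ fun t ht => ?_⟩
  rw [exampleMap_iterate, orbitY]
  dsimp only
  rw [show i + (lenW (i + j + l + 1) + j - i + t) = lenW (i + j + l + 1) + (j + t) by omega,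
    pointY_lenW_add (by omega)]

/-- Given two words of `y`, the first one can be followed, after the same gap, both by the second
one and by a block of ones. -/
theorem exists_word_and_ones (i j m : ℕ) : ∃ n c, 0 < n ∧
    (∀ t < m, pointY (c + t) = pointY (i + t)) ∧
    ∀ t < m, pointY (i + (n + t)) = pointY (j + t) ∧ pointY (c + (n + t)) = true := by
  set J := i + j + m + 1 with hJ
  have h0 : i + j + m < lenW J := exists_lt_lenW _
  have h1 := lenC_le_lenW (n := J) (by omega)
  have h2 := lenW_le J
  have h3 := lenW_succ J
  have h4 := eight_mul_le (n := J + 1) (by omega)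
  have h5 : lenC (J + 2) = _ := lenC_succ (n := J + 1) (by omega)
  -- After this delay, position i reaches the copy of j in the second W₀ … W_J, whereas its copy c
  -- reaches the prefix of x after it, inside the ones of C_{J+1}.
  refine ⟨lenW (J + 1) + j - i, lenW (J + 1) + (lenW J + i), by omega, fun t ht => ?_,
    fun t ht => ⟨?_, ?_⟩⟩
  · rw [add_assoc, pointY_lenW_add (by omega), add_assoc, pointY_lenW_add (by omega)]
  · rw [show i + (lenW (J + 1) + j - i + t) = lenW (J + 1) + (j + t) by omega,
      pointY_lenW_add (by omega)]
  · rw [show lenW (J + 1) + (lenW J + i) + (lenW (J + 1) + j - i + t)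
        = 2 * lenW (J + 1) + (lenW J + j + t) by omega,
      pointY_two_lenW_add (by rw [show J + 1 + 1 = J + 2 from rfl]; omega),
      pointX_true (n := J + 1) (by omega) (by omega) (by omega)]

theorem not_isEquicontinuityPair (a b : exampleShift) : ¬ IsEquicontinuityPair exampleMap a b := by
  intro h
  by_cases hb : ∃ s, b.1 s = false
  · obtain ⟨s, hs⟩ := hb
    obtain ⟨U, hU, V, hV, hUV⟩ := h _ (mem_nhds_of_coord b s)
    obtain ⟨i, m, -, -, hi⟩ := exists_word_of_mem_nhds hU 0
    obtain ⟨j, l, hl, -, hj⟩ := exists_word_of_mem_nhds hV (s + 1)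
    obtain ⟨n, c, hn, hc, hc'⟩ := exists_word_and_ones i j (m + l)
    have hsub := hUV n hn ⟨_, ⟨orbitY i, hi _ fun _ _ => rfl, rfl⟩, hj _ fun t ht => by
      rw [exampleMap_iterate]; exact (hc' t (by omega)).1⟩
    have : _ = _ := hsub ⟨orbitY c, hi _ fun t ht => hc t (by omega), rfl⟩
    rw [exampleMap_iterate, hs] at this
    exact absurd ((hc' s (by omega)).2.symm.trans this) (by simp)
  -- Here b is 1^∞, so the roles are exchanged: the block of ones brings an iterate close to b, and
  -- the word of y at 1, starting with 0, takes it away.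
  · push Not at hb
    obtain ⟨U, hU, V, hV, hUV⟩ := h _ (mem_nhds_of_coord b 0)
    obtain ⟨i, m, -, -, hi⟩ := exists_word_of_mem_nhds hU 0
    obtain ⟨j, l, hl, hbj, hj⟩ := exists_word_of_mem_nhds hV 1
    obtain ⟨n, c, hn, hc, hc'⟩ := exists_word_and_ones i 1 (m + l)
    have hsub := hUV n hn ⟨_, ⟨orbitY c, hi _ fun t ht => hc t (by omega), rfl⟩,
      hj _ fun t ht => by
        rw [exampleMap_iterate, ← hbj t ht]
        exact (hc' t (by omega)).2.trans (by simpa using (hb t).symm)⟩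
    have : _ = _ := hsub ⟨orbitY i, hi _ fun _ _ => rfl, rfl⟩
    rw [exampleMap_iterate] at this
    have h1 := (hc' 0 (by omega)).1.symm.trans this
    exact hb 0 (h1.symm.trans pointY_one)

theorem isSensitive_exampleMap : IsSensitive exampleMap := by
  refine ⟨{q | q.1.1 0 = q.2.1 0}, mem_uniformity_iff.2 ⟨1, fun z z' h => h 0 one_pos⟩,
    fun U hU ⟨a, ha⟩ => ?_⟩
  obtain ⟨i, m, -, -, hi⟩ := exists_word_of_mem_nhds (hU.mem_nhds ha) 0
  obtain ⟨n, c, hn, hc, hc'⟩ := exists_word_and_ones i 1 (m + 1)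
  refine ⟨orbitY i, hi _ fun _ _ => rfl, orbitY c, hi _ fun t ht => hc t (by omega), n, hn,
    fun h => ?_⟩
  have h : _ = _ := h
  rw [exampleMap_iterate, exampleMap_iterate] at h
  obtain ⟨h1, h2⟩ := hc' 0 (by omega)
  exact absurd ((h1.symm.trans h).trans h2) (by rw [pointY_one]; simp)

/-! ### The even continuity pair -/

/-- An occurrence of `101` in `y` is the start of a copy of some `C₀ … Cₖ₋₁ Qₖ`. -/
theorem exists_climb_of_start {i : ℕ} (h0 : pointY i = true) (h1 : pointY (i + 1) = false)
    (h2 : pointY (i + 2) = true) : ∃ k n c, 1 ≤ k ∧ k ≤ n ∧ c k = 2 * lenW (k - 1) ∧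
      IsClimb k c ∧ ∀ m, n ≤ m → c m = i := by
  obtain ⟨k, r, c, hk, hkn, hr, hck, hc, hm⟩ := exists_climb (exists_lt_lenW i)
  obtain ⟨j, rfl⟩ := Nat.exists_eq_add_of_le' hk
  refine ⟨j + 1, i + 1, c, hk, hkn, hck, hc, ?_⟩
  suffices hr0 : r = 0 by simpa [hr0] using hm
  rw [Nat.add_sub_cancel] at hck
  have hs := lenW_succ j
  have hr : r < lenC (j + 2) := hr
  have key : ∀ t, r + t < lenC (j + 2) → pointY (i + t) = pointY (2 * lenW j + (r + t)) := by
    intro t ht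
    rw [← hm _ le_rfl, add_assoc, hc.pointY_eq le_rfl hkn (by omega), hck]
  -- For r > 0 the descent would end the run of ones of some Cₙ with n ≥ 1, and at least two zeros
  -- follow it, so the third letter could not be 1.
  by_contra hr0
  have hlen := lenC_growth (n := j + 1) (by omega)
  have hlen' := two_le_lenC (n := j + 1) (by omega)
  rw [show j + 1 + 1 = j + 2 from rfl] at hlen
  have e0 := key 0 hr
  rw [add_zero, add_zero, h0] at e0
  have hrj : r < lenC (j + 1) := by
    by_contra h
    rw [pointY_two_lenW_add_false (by omega) hr] at e0
    simp at e0
  rw [pointY_two_lenW_add hrj] at e0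
  have hrj' : r + 1 < lenC (j + 1) := by
    by_contra h
    have := pointX_pred_lenC (n := j + 1) (by omega)
    rw [show lenC (j + 1) - 1 = r by omega, ← e0] at this
    simp at this
  have e1 := key 1 (by omega)
  rw [pointY_two_lenW_add hrj', h1] at e1
  obtain ⟨n, hn, hrn⟩ := exists_level_of_descent (by omega) e0.symm e1.symm
  have e2 := key 2 (by omega)
  rw [h2] at e2
  rcases lt_or_ge (r + 2) (lenC (j + 1)) with h | h
  · rw [pointY_two_lenW_add h, pointX_false hn (by omega)] at e2
    · simp at e2
    · have := lenC_succ hn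
      have := four_le_two_pow_mul hn
      omega
  · rw [pointY_two_lenW_add_false h (by omega)] at e2
    simp at e2

theorem exists_gap {t : ℕ} (ht : 1 ≤ t) (hx : pointX t = false) :
    t = 1 ∨ ∃ n, 1 ≤ n ∧ lenC n + 8 ^ n * lenC n ≤ t ∧ t < lenC (n + 1) := by
  have hex : ∃ n, t < lenC n := ⟨t + 1, (Nat.lt_succ_self t).trans_le lenC_strictMono.le_apply⟩
  obtain ⟨n, hn⟩ : ∃ n, Nat.find hex = n + 1 := by
    refine Nat.exists_eq_succ_of_ne_zero fun h0 => ?_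
    have := Nat.find_spec hex
    rw [h0, lenC_zero] at this
    omega
  have h1 : t < lenC (n + 1) := hn ▸ Nat.find_spec hex
  have h2 : lenC n ≤ t := not_lt.1 (Nat.find_min hex (m := n) (by omega))
  rcases Nat.eq_zero_or_pos n with rfl | h3
  · rw [zero_add, lenC_one] at h1
    exact Or.inl (by omega)
  · refine Or.inr ⟨n, h3, ?_, h1⟩
    by_contra h
    rw [pointX_true h3 h2 (by omega)] at hx
    simp at hx

/-- The points of the subshift starting with `101` vanish where `x` does. -/
theorem eq_false_of_start (z : exampleShift) (h0 : z.1 0 = true) (h1 : z.1 1 = false)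
    (h2 : z.1 2 = true) {t : ℕ} (hx : pointX t = false) : z.1 t = false := by
  obtain ⟨i, hi⟩ := mem_exampleShift_iff.1 z.2 (t + 3)
  obtain ⟨k, n, c, hk, hkn, hck, hc, hm⟩ := exists_climb_of_start (i := i)
    ((hi 0 (by omega)).symm.trans h0) ((hi 1 (by omega)).symm.trans h1)
    ((hi 2 (by omega)).symm.trans h2)
  rcases Nat.eq_zero_or_pos t with rfl | ht
  · rw [pointX_zero] at hx
    simp at hx
  rcases exists_gap ht hx with rfl | ⟨j, hj, hj1, hj2⟩
  · exact h1
  rw [hi t (by omega)]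
  have h8 := eight_mul_le hj
  obtain ⟨k, rfl⟩ := Nat.exists_eq_add_of_le' hk
  -- Gaps of x above the base level are zeros of every climb; those at or below it are read inside
  -- C₀ … Cₖ Qₖ₊₁ itself, where the letters are those of x or zeros.
  rcases lt_or_ge (k + 1) j with h | h
  · rw [← hm (n + j) (by omega)]
    exact hc.pointY_false h (by omega) (by omega) hj2
  · have hs := lenW_succ k
    have hl : lenC (j + 1) ≤ lenC (k + 2) := lenC_strictMono.monotone (by omega)
    rw [← hm n le_rfl, hc.pointY_eq le_rfl hkn (by rw [hck, Nat.add_sub_cancel]; omega), hck,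
      Nat.add_sub_cancel]
    rcases lt_or_ge t (lenC (k + 1)) with h' | h'
    · rw [pointY_two_lenW_add h', hx]
    · exact pointY_two_lenW_add_false h' (by omega)

/-- The cylinder of `101` is a neighbourhood of `x`. -/
theorem start_mem_nhds : {z : exampleShift | z.1 0 = true ∧ z.1 1 = false ∧ z.1 2 = true} ∈
    𝓝 (⟨pointX, pointX_mem⟩ : exampleShift) :=
  mem_nhds_subtype_iff.2 ⟨3, fun z hz => ⟨hz 0 (by omega), hz 1 (by omega), hz 2 (by omega)⟩⟩

theorem pointX_false_gap (n : ℕ) : ∃ i, n < i ∧ ∀ t < n, pointX (i + t) = false := by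
  have h1 : n + 1 ≤ lenC (n + 1) := lenC_strictMono.le_apply
  have h2 := lenC_succ (n := n + 1) (by omega)
  have h3 : 2 ^ 1 ≤ 2 ^ (n + 1) := Nat.pow_le_pow_right (by norm_num) (by omega)
  have h4 := Nat.mul_le_mul_right (lenC (n + 1)) h3
  exact ⟨lenC (n + 1) + 8 ^ (n + 1) * lenC (n + 1), by omega, fun t ht =>
    pointX_false (n := n + 1) (by omega) (by omega) (by omega)⟩

theorem isNontrivialEvenContinuityPair :
    IsNontrivialEvenContinuityPair exampleMap ⟨pointX, pointX_mem⟩ ⟨zeroSeq, zeroSeq_mem⟩ := by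
  constructor
  · intro O hO
    obtain ⟨m, hm⟩ := mem_nhds_subtype_iff.1 hO
    refine ⟨_, start_mem_nhds, {z | ∀ t < m, z.1 t = false},
      mem_nhds_subtype_iff.2 ⟨m, fun z hz => hz⟩, fun n _ hn => ?_⟩
    rintro _ ⟨z, ⟨h0, h1, h2⟩, rfl⟩
    refine hm _ fun t ht => ?_
    rw [exampleMap_iterate]
    refine eq_false_of_start z h0 h1 h2 ?_
    have := hn t ht
    rwa [exampleMap_iterate] at this
  · rw [omegaSet, mem_omegaLimit_singleton_iff_mapClusterPt, mapClusterPt_iff_frequently]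
    intro s hs
    obtain ⟨m, hm⟩ := mem_nhds_subtype_iff.1 hs
    rw [frequently_atTop]
    intro N
    obtain ⟨i, hi, hi'⟩ := pointX_false_gap (N + m)
    refine ⟨i, by omega, hm _ fun t ht => ?_⟩
    rw [exampleMap_iterate]
    exact hi' t (by omega)

/-- A periodic point starting with 101 shows a 1 at every multiple of its period, yet it must vanish
on the zero runs of x, some of which are as long as that period. -/
theorem not_dense_periodicPts : ¬ Dense (Function.periodicPts exampleMap) := by
  intro h
  obtain ⟨z, ⟨h0, h1, h2⟩, q, hq, hz⟩ := mem_closure_iff_nhds.1 (h ⟨pointX, pointX_mem⟩) _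
    start_mem_nhds
  obtain ⟨i, hi, hi'⟩ := pointX_false_gap q
  have hz' := hz.mul_const (i / q + 1)
  have h3 : z.1 (q * (i / q + 1)) = true := by
    have := exampleMap_iterate (q * (i / q + 1)) z 0
    rw [hz'.eq, h0] at this
    exact this.symm
  have h4 := Nat.div_add_mod i q
  have h5 := Nat.mod_lt i hq
  have h6 : q * (i / q + 1) = i + (q - i % q) := by rw [mul_add]; omega
  rcases Nat.eq_zero_or_pos (i % q) with h7 | h7
  · have h8 := (hz.mul_const (i / q)).eq
    have h9 := exampleMap_iterate (q * (i / q)) z 0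
    rw [h8, h0, add_zero, show q * (i / q) = i + 0 by omega,
      eq_false_of_start z h0 h1 h2 (hi' 0 hq)] at h9
    simp at h9
  · rw [h6, eq_false_of_start z h0 h1 h2 (hi' _ (by omega))] at h3
    simp at h3

/-! ### No point of even continuity -/

/-- The descents `10` can be avoided at any prescribed late time after a given word of `y`. -/
theorem exists_avoid_descent (i m : ℕ) : ∃ N, ∀ n ≥ N, ∃ c, (∀ t < m, pointY (c + t) =
    pointY (i + t)) ∧ ¬ (pointY (c + n) = true ∧ pointY (c + (n + 1)) = false) := by
  set J := i + m + 1 with hJ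
  have hiJ : i + m < lenW J := exists_lt_lenW _
  let c : ℕ → ℕ := fun n => i + ∑ j ∈ Finset.Ico J n, lenW j
  have hcJ : c J = i := by simp [c]
  have hstep : ∀ n, J ≤ n → c (n + 1) = lenW n + c n := fun n hn => by
    simp only [c]
    rw [Finset.sum_Ico_succ_top hn]
    omega
  have hc : IsClimb J c := ⟨by omega, fun n hn => Or.inr (hstep n hn)⟩
  have hagree : ∀ n, J ≤ n → ∀ t < m, pointY (c n + t) = pointY (i + t) := fun n hn t ht => by
    rw [hc.pointY_eq le_rfl hn (by omega), hcJ]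
  have hsucc : ∀ n, J ≤ n → lenW (n + 1) - c (n + 1) = lenW n - c n + lenC (n + 2) :=
    fun n hn => by
      have h1 := lenW_succ n
      have h2 := hstep n hn
      have h3 := hc.lt hn
      omega
  refine ⟨lenW (J + 1) - c (J + 1), fun n hn => ?_⟩
  -- K is the level at which the reading time n has left W₀ … W_{K-1} but not yet W₀ … W_K. With t
  -- the excess, the copy `c K` reads y at t and the copy `c (K + 1)` reads the block C₀ … C_K
  -- Q_{K+1} at t.
  obtain ⟨K, hJK, hK1, hK2⟩ : ∃ K, J + 1 ≤ K ∧ lenW K - c K ≤ n ∧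
      n < lenW (K + 1) - c (K + 1) := by
    have hex : ∃ d, n < lenW (J + 1 + d) - c (J + 1 + d) := by
      have hd : ∀ d, d ≤ lenW (J + 1 + d) - c (J + 1 + d) := fun d => by
        induction d with
        | zero => exact Nat.zero_le _
        | succ d ih =>
          have h1 := hsucc (J + 1 + d) (by omega)
          have h2 := two_le_lenC (n := J + 1 + d + 2) (by omega)
          rw [← add_assoc]
          omega
      exact ⟨n + 1, hd (n + 1)⟩
    obtain ⟨d, hd⟩ : ∃ d, Nat.find hex = d + 1 := by
      refine Nat.exists_eq_succ_of_ne_zero fun h0 => ?_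
      have := Nat.find_spec hex
      rw [h0, add_zero] at this
      omega
    refine ⟨J + 1 + d, by omega, not_lt.1 (Nat.find_min hex (m := d) (by omega)), ?_⟩
    have := Nat.find_spec hex
    rwa [hd, ← add_assoc] at this
  have hcK := hc.lt (n := K) (by omega)
  have hsK := hsucc K (by omega)
  have hlK := lenC_le_lenW (n := K) (by omega)
  obtain ⟨t, rfl⟩ : ∃ t, n = lenW K - c K + t := ⟨n - (lenW K - c K), by omega⟩
  -- At t = 0 both x and y start with 10, so the copy one level lower is used instead; it is then
  -- among the zeros of Qₖ₊₁.
  rcases Nat.eq_zero_or_pos t with rfl | ht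
  · obtain ⟨k, rfl⟩ := Nat.exists_eq_add_of_le' (show 1 ≤ K by omega)
    refine ⟨c k, hagree k (by omega), fun h => ?_⟩
    have h1 := hsucc k (by omega)
    have h2 := hc.lt (n := k) (by omega)
    have h3 := lenW_le k
    have h4 : 9 * lenC (k + 1) + 2 * lenC (k + 1) ≤ lenC (k + 2) := lenC_growth (by omega)
    have h5 := two_le_lenC (n := k + 1) (by omega)
    have h6 := h.1
    rw [h1, show c k + (lenW k - c k + lenC (k + 2) + 0)
      = 2 * lenW k + (lenC (k + 2) - lenW k) by omega] at h6
    rcases Nat.eq_zero_or_pos (lenW k) with h7 | h7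
    · have := lenW_strictMono.le_apply (x := k)
      omega
    rw [pointY_two_lenW_add_false (by omega) (by omega)] at h6
    simp at h6
  by_cases hd : pointY (c (K + 1) + (lenW K - c K + t)) = true ∧
    pointY (c (K + 1) + (lenW K - c K + t + 1)) = false
  swap
  · exact ⟨_, hagree (K + 1) (by omega), hd⟩
  rw [hstep K (by omega), show lenW K + c K + (lenW K - c K + t) = 2 * lenW K + t by omega,
    show lenW K + c K + (lenW K - c K + t + 1) = 2 * lenW K + (t + 1) by omega] at hd
  obtain ⟨hd1, hd2⟩ := hd
  have htK : t < lenC (K + 1) := by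
    by_contra h
    rw [pointY_two_lenW_add_false (by omega) (by omega)] at hd1
    simp at hd1
  rw [pointY_two_lenW_add htK] at hd1
  have htK' : t + 1 < lenC (K + 1) := by
    by_contra h
    have := pointX_pred_lenC (n := K + 1) (by omega)
    rw [show lenC (K + 1) - 1 = t by omega, hd1] at this
    simp at this
  rw [pointY_two_lenW_add htK'] at hd2
  refine ⟨c K, hagree K (by omega), fun h => ?_⟩
  have h1 := h.1
  rw [show c K + (lenW K - c K + t) = lenW K + t by omega, pointY_lenW_add (by omega),
    pointY_false_of_descent ht hd1 hd2] at h1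
  simp at h1

theorem eq_of_no_descent {a : ℕ → Bool} {N : ℕ}
    (h : ∀ n ≥ N, ¬ (a n = true ∧ a (n + 1) = false)) : ∃ M, ∀ n ≥ M, a n = a M := by
  by_cases hM : ∃ M ≥ N, a M = true
  · obtain ⟨M, hMN, hM⟩ := hM
    refine ⟨M, fun n hn => ?_⟩
    induction n, hn using Nat.le_induction with
    | base => rfl
    | succ k hk ih =>
      have := h k (hMN.trans hk)
      rw [ih, hM] at this
      simpa [hM] using this
  · push Not at hM
    refine ⟨N, fun n hn => ?_⟩
    have h1 := hM n hn
    have h2 := hM N le_rfl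
    simp only [ne_eq, Bool.not_eq_true] at h1 h2
    rw [h1, h2]

theorem exists_pointY_eq (b : Bool) (N : ℕ) : ∃ n ≥ N, pointY n = b := by
  have h := exists_lt_lenW N
  have h1 : 2 ≤ lenW (N + 1) := by
    have h2 := two_le_lenC (n := N + 2) (by omega)
    have h3 := lenW_succ N
    omega
  cases b
  · exact ⟨lenW (N + 1) + 1, by omega, pointY_lenW_add (t := 1) (by omega)⟩
  · exact ⟨lenW (N + 1), by omega, pointY_lenW (by omega)⟩

instance : CompactSpace exampleShift :=
  isCompact_iff_compactSpace.1 isSubshift_exampleShift.isClosed.isCompact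

/-- If a has infinitely many descents, its orbit accumulates at some b starting with 10, and nearby
points avoid 10 at every late time. Otherwise a is eventually constant and its orbit reaches a fixed
point, while nearby orbit points of y keep showing both letters. -/
theorem not_isEvenContinuityPoint (a : exampleShift) :
    ¬ IsEvenContinuityPoint exampleMap a := by
  intro h
  by_cases ha : ∃ᶠ n in atTop, a.1 n = true ∧ a.1 (n + 1) = false
  · set S : Set exampleShift := {z | z.1 0 = true ∧ z.1 1 = false} with hS
    have hSc : IsCompact S := by
      refine IsClosed.isCompact (IsClosed.inter ?_ ?_)
      · exact isClosed_eq ((continuous_apply 0).comp continuous_subtype_val) continuous_const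
      · exact isClosed_eq ((continuous_apply 1).comp continuous_subtype_val) continuous_const
    obtain ⟨b, hb, hcl⟩ := hSc.exists_mapClusterPt_of_frequently
      (f := fun n => exampleMap^[n] a) (l := atTop) (ha.mono fun n hn => by
        rw [hS, Set.mem_ofPred_eq, exampleMap_iterate, exampleMap_iterate]; exact hn)
    rw [mapClusterPt_iff_frequently] at hcl
    have hSb : S ∈ 𝓝 b := mem_nhds_subtype_iff.2 ⟨2, fun z hz =>
      ⟨(hz 0 (by omega)).trans hb.1, (hz 1 (by omega)).trans hb.2⟩⟩
    obtain ⟨U, hU, V, hV, hUV⟩ := h b S hSb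
    obtain ⟨i, m, -, -, hi⟩ := exists_word_of_mem_nhds hU 0
    obtain ⟨N, hN⟩ := exists_avoid_descent i m
    obtain ⟨n, hn, hnV⟩ := frequently_atTop.1 (hcl V hV) (N + 1)
    obtain ⟨c, hc, hc'⟩ := hN n (by omega)
    have hmem := hUV n (by omega) hnV ⟨orbitY c, hi _ hc, rfl⟩
    rw [hS, Set.mem_ofPred_eq, exampleMap_iterate, exampleMap_iterate] at hmem
    exact hc' hmem
  · rw [not_frequently] at ha
    obtain ⟨N, hN⟩ := eventually_atTop.1 ha
    obtain ⟨M, hM⟩ := eq_of_no_descent hN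
    obtain ⟨U, hU, V, hV, hUV⟩ := h (exampleMap^[M] a) _ (mem_nhds_of_coord _ 0)
    obtain ⟨i, m, -, -, hi⟩ := exists_word_of_mem_nhds hU 0
    obtain ⟨n, hn, hne⟩ := exists_pointY_eq (!(a.1 M)) (i + M + 1)
    have hV' : exampleMap^[n - i] a ∈ V := by
      convert mem_of_mem_nhds hV using 1
      refine Subtype.ext (funext fun t => ?_)
      rw [exampleMap_iterate, exampleMap_iterate, hM _ (by omega), hM (M + t) (by omega)]
    have hmem : _ = _ := hUV (n - i) (by omega) hV' ⟨orbitY i, hi _ fun _ _ => rfl, rfl⟩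
    rw [exampleMap_iterate, exampleMap_iterate] at hmem
    change pointY (i + (n - i + 0)) = a.1 M at hmem
    rw [show i + (n - i + 0) = n by omega, hne] at hmem
    simp at hmem

/-! ### Scrambled sets -/

/-- The position obtained from `i` by passing to the second copy of `W₀ … Wⱼ₋₁` at all levels
`J ≤ j < n` with `δ j = true`. -/
def climbPos (J i : ℕ) (δ : ℕ → Bool) (n : ℕ) : ℕ :=
  i + ∑ j ∈ Finset.Ico J n, if δ j then lenW j else 0

theorem climbPos_self (J i : ℕ) (δ : ℕ → Bool) : climbPos J i δ J = i := by
  simp [climbPos]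

theorem climbPos_succ {J n : ℕ} (i : ℕ) (δ : ℕ → Bool) (hn : J ≤ n) :
    climbPos J i δ (n + 1) = (if δ n then lenW n else 0) + climbPos J i δ n := by
  rw [climbPos, climbPos, Finset.sum_Ico_succ_top hn]
  omega

theorem isClimb_climbPos {J i : ℕ} (δ : ℕ → Bool) (hi : i < lenW J) :
    IsClimb J (climbPos J i δ) where
  base := by rwa [climbPos_self]
  step n hn := by
    rw [climbPos_succ i δ hn]
    split
    · exact Or.inr rfl
    · exact Or.inl (zero_add _)

/-- The limit of the points `σ^(c n) y` along a climb `c`. -/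
def climbSeq (J : ℕ) (c : ℕ → ℕ) : ℕ → Bool := fun t => pointY (c (J + t) + t)

namespace IsClimb

variable {J J' : ℕ} {c c' : ℕ → ℕ}

/-- The unread part grows by at least one letter per level, so level `J + t` determines letter t in
`climbSeq`. -/
theorem add_lt (h : IsClimb J c) (t : ℕ) : c (J + t) + t < lenW (J + t) := by
  induction t with
  | zero => exact h.base
  | succ t ih =>
    have h1 := h.add_lenC_le (n := J + t) (by omega)
    have h2 := two_le_lenC (n := J + t + 2) (by omega)
    rw [← add_assoc J t 1]
    omega

theorem climbSeq_eq (h : IsClimb J c) {n t : ℕ} (hn : J ≤ n) (ht : c n + t < lenW n) :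
    climbSeq J c t = pointY (c n + t) := by
  rw [climbSeq]
  rcases le_total n (J + t) with h' | h'
  · exact h.pointY_eq hn h' ht
  · exact (h.pointY_eq (by omega) h' (h.add_lt t)).symm

theorem climbSeq_mem (h : IsClimb J c) : climbSeq J c ∈ exampleShift := by
  refine mem_exampleShift_iff.2 fun m => ⟨c (J + m), fun t ht => ?_⟩
  exact h.climbSeq_eq (by omega) (by have := h.add_lt m; omega)

theorem climbSeq_false (h : IsClimb J c) {n t : ℕ} (hn : J + 1 ≤ n) (h1 : 5 * lenC n ≤ t)
    (h2 : t < lenC (n + 1)) : climbSeq J c t = false := by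
  have h3 := h.lenC_le hn
  rw [h.climbSeq_eq (n := n) (by omega) (by omega)]
  exact pointY_false_of_lenC_le (by omega) h3 h1 h2

/-- Staying in the first copy means that the second copy is read after `lenW n` steps. The return
time does not depend on the climb, so two climbs can return together. -/
theorem climbSeq_return (h : IsClimb J c) {n t : ℕ} (hn : J ≤ n) (hcn : c (n + 1) = c n)
    (ht : c n + t < lenW n) : climbSeq J c (lenW n + t) = climbSeq J c t := by
  have h1 := lenW_succ n
  rw [h.climbSeq_eq hn ht, h.climbSeq_eq (n := n + 1) (by omega) (by omega), hcn,
    show c n + (lenW n + t) = lenW n + (c n + t) by omega, pointY_lenW_add ht]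

/-- The climb that is further along has just finished W₀ … Wₙ₋₁ and reads the initial 1 of what
follows; the other is still in the final zeros, since positions differ by much less than their
length. -/
theorem climbSeq_ne_of_lt (h : IsClimb J c) (h' : IsClimb J' c') {n : ℕ} (hn : J + 1 ≤ n)
    (hn' : J' + 1 ≤ n) (hlt : c n < c' n) :
    climbSeq J c (lenW n - c' n) = false ∧ climbSeq J' c' (lenW n - c' n) = true := by
  have h1 := h'.lenC_le hn'
  have h2 := h'.step n (by omega)
  have h3 := lenW_succ n
  have h4 := two_le_lenC (n := n + 2) (by omega)
  have h5 := two_le_lenC (n := n + 1) (by omega)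
  constructor
  · rw [h.climbSeq_eq (n := n) (by omega) (by omega)]
    refine EvenCty.pointY_false (n := n) (by omega) ?_ (by omega)
    obtain ⟨k, rfl⟩ := Nat.exists_eq_add_of_le' (show 1 ≤ n by omega)
    have h6 := lenW_succ k
    have h7 := lenW_le k
    have h8 := lenC_growth (n := k + 1) (by omega)
    rw [show k + 1 + 1 = k + 2 from rfl] at *
    omega
  · rw [h'.climbSeq_eq (n := n + 1) (by omega) (by omega)]
    rcases h2 with h2 | h2
    · rw [h2, show c' n + (lenW n - c' n) = lenW n by omega, pointY_lenW (by omega)]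
    · rw [h2, show lenW n + c' n + (lenW n - c' n) = 2 * lenW n by omega, pointY_two_lenW]

theorem climbSeq_ne (h : IsClimb J c) (h' : IsClimb J' c') {n : ℕ} (hn : J + 1 ≤ n)
    (hn' : J' + 1 ≤ n) (hne : c n ≠ c' n) : ∃ t ≥ n, climbSeq J c t ≠ climbSeq J' c' t := by
  have h0 : n + 1 ≤ lenC (n + 1) := lenC_strictMono.le_apply
  have h1 := h.lenC_le hn
  have h2 := h'.lenC_le hn'
  rcases lt_or_gt_of_ne hne with hlt | hlt
  · refine ⟨lenW n - c' n, by omega, ?_⟩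
    obtain ⟨h3, h4⟩ := h.climbSeq_ne_of_lt h' hn hn' hlt
    rw [h3, h4]
    simp
  · refine ⟨lenW n - c n, by omega, ?_⟩
    obtain ⟨h3, h4⟩ := h'.climbSeq_ne_of_lt h hn' hn hlt
    rw [h3, h4]
    simp

end IsClimb

theorem isStrongLiYorkePair_climbSeq {J J' : ℕ} {c c' : ℕ → ℕ} (h : IsClimb J c)
    (h' : IsClimb J' c') (hret : ∃ᶠ n in atTop, c (n + 1) = c n ∧ c' (n + 1) = c' n)
    (hne : ∃ᶠ n in atTop, c n ≠ c' n) :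
    IsStrongLiYorkePair exampleMap ⟨_, h.climbSeq_mem⟩ ⟨_, h'.climbSeq_mem⟩ := by
  refine ⟨⟨fun D hD => ?_, fun hlim => ?_⟩, ?_⟩
  · obtain ⟨m, hm⟩ := mem_uniformity_iff.1 hD
    refine frequently_atTop.2 fun N => ⟨5 * lenC (J + J' + m + N + 1), ?_, hm _ _ fun t ht => ?_⟩
    · have : J + J' + m + N + 1 ≤ lenC (J + J' + m + N + 1) := lenC_strictMono.le_apply
      omega
    · have h1 : J + J' + m + N + 1 ≤ lenC (J + J' + m + N + 1) := lenC_strictMono.le_apply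
      have h2 := lenC_growth (n := J + J' + m + N + 1) (by omega)
      rw [exampleMap_iterate, exampleMap_iterate]
      change climbSeq J c _ = climbSeq J' c' _
      rw [h.climbSeq_false (n := J + J' + m + N + 1) (by omega) (by omega) (by omega),
        h'.climbSeq_false (n := J + J' + m + N + 1) (by omega) (by omega) (by omega)]
  · have hD : {q : exampleShift × exampleShift | q.1.1 0 = q.2.1 0} ∈ 𝓤 exampleShift :=
      mem_uniformity_iff.2 ⟨1, fun z z' h => h 0 one_pos⟩
    obtain ⟨N, hN⟩ := eventually_atTop.1 (hlim.eventually hD)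
    obtain ⟨n, hn, hn'⟩ := frequently_atTop.1 hne (J + J' + N + 1)
    obtain ⟨t, ht, ht'⟩ := h.climbSeq_ne h' (by omega) (by omega) hn'
    have : _ = _ := hN t (by omega)
    rw [exampleMap_iterate, exampleMap_iterate] at this
    exact ht' this
  · rw [IsRecurrent, omegaSet, mem_omegaLimit_singleton_iff_mapClusterPt,
      mapClusterPt_iff_frequently]
    intro s hs
    rw [nhds_prod_eq, mem_prod_iff] at hs
    obtain ⟨U, hU, V, hV, hUV⟩ := hs
    obtain ⟨m, hm⟩ := mem_nhds_subtype_iff.1 hU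
    obtain ⟨l, hl⟩ := mem_nhds_subtype_iff.1 hV
    refine frequently_atTop.2 fun N => ?_
    obtain ⟨n, hn, h1, h2⟩ := frequently_atTop.1 hret (J + J' + m + l + N + 1)
    have h0 : n + 1 ≤ lenC (n + 1) := lenC_strictMono.le_apply
    have h3 := h.lenC_le (n := n) (by omega)
    have h4 := h'.lenC_le (n := n) (by omega)
    refine ⟨lenW n, by omega, hUV ?_⟩
    rw [Prod.map_iterate]
    refine ⟨hm _ fun t ht => ?_, hl _ fun t ht => ?_⟩
    · rw [Prod.map_apply, exampleMap_iterate]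
      exact h.climbSeq_return (by omega) h1 (by omega)
    · rw [Prod.map_apply, exampleMap_iterate]
      exact h'.climbSeq_return (by omega) h2 (by omega)

/-- A sequence of bits in which every bit of `γ` is repeated infinitely often, interspersed with
zeros. -/
def spread (γ : ℕ → Bool) (n : ℕ) : Bool := n.bodd && γ n.div2.unpair.1

theorem spread_two_mul (γ : ℕ → Bool) (n : ℕ) : spread γ (2 * n) = false := by
  simp [spread]

theorem spread_bit_pair (γ : ℕ → Bool) (k l : ℕ) :
    spread γ (2 * Nat.pair k l + 1) = γ k := by
  simp [spread, Nat.div2_val]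

theorem isClimb_spread (i m : ℕ) (γ : ℕ → Bool) :
    IsClimb (i + m + 1) (climbPos (i + m + 1) i (spread γ)) :=
  isClimb_climbPos _ ((Nat.le_add_right i m).trans_lt (exists_lt_lenW (i + m)))

/-- The member of the scrambled set given by the starting position `i`, the level
`i + m + 1` and the sequence `γ`. -/
def scrambled (i m : ℕ) (γ : ℕ → Bool) : exampleShift :=
  ⟨_, (isClimb_spread i m γ).climbSeq_mem⟩

theorem scrambled_agree (i m : ℕ) (γ : ℕ → Bool) {t : ℕ} (ht : t < m) :
    (scrambled i m γ).1 t = pointY (i + t) := by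
  have h := exists_lt_lenW (i + m)
  refine ((isClimb_spread i m γ).climbSeq_eq le_rfl ?_).trans ?_ <;> rw [climbPos_self]
  omega

theorem isStrongLiYorkePair_scrambled (i m i' m' : ℕ) {γ γ' : ℕ → Bool} (hγ : γ ≠ γ') :
    IsStrongLiYorkePair exampleMap (scrambled i m γ) (scrambled i' m' γ') := by
  refine isStrongLiYorkePair_climbSeq (isClimb_spread i m γ)
    (isClimb_spread i' m' γ') ?_ ?_
  · refine frequently_atTop.2 fun N => ⟨2 * (N + i + m + i' + m' + 1), by omega, ?_, ?_⟩ <;>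
    · rw [climbPos_succ _ _ (by omega), spread_two_mul]
      simp
  · obtain ⟨k, hk⟩ := Function.ne_iff.1 hγ
    refine frequently_atTop.2 fun N => ?_
    set l := N + i + m + i' + m' + 1 with hl
    obtain ⟨n, hn⟩ : ∃ n, n = 2 * Nat.pair k l + 1 := ⟨_, rfl⟩
    have h1 : l ≤ Nat.pair k l := Nat.right_le_pair k l
    -- At a level where the bits differ, equal positions become distinct at the next level, so one
    -- of n and n + 1 always works.
    by_cases h : climbPos (i + m + 1) i (spread γ) n = climbPos (i' + m' + 1) i' (spread γ') n
    · refine ⟨n + 1, by omega, ?_⟩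
      rw [climbPos_succ _ _ (by omega), climbPos_succ _ _ (by omega), h]
      have h4 : 0 < lenW n := hn ▸ (Nat.zero_le _).trans_lt (exists_lt_lenW (2 * Nat.pair k l))
      have h5 : spread γ n = γ k := hn ▸ spread_bit_pair γ k l
      have h6 : spread γ' n = γ' k := hn ▸ spread_bit_pair γ' k l
      rw [h5, h6]
      clear_value l
      clear h h5 h6 hn
      cases h2 : γ k <;> cases h3 : γ' k <;> simp_all [h4.ne']
    · exact ⟨n, by omega, h⟩

theorem exists_strongly_scrambled : ∃ S : Set exampleShift, ¬ S.Countable ∧ Dense S ∧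
    S.Pairwise (IsStrongLiYorkePair exampleMap) := by
  have hcard : Cardinal.mk (ℕ → Bool) = Cardinal.continuum := by simp
  -- Strong scrambling needs only distinct codes, so each code may choose its own initial word;
  -- surjectivity of θ then makes the set dense.
  obtain ⟨θ, hθ⟩ : ∃ θ : (ℕ → Bool) → ℕ × ℕ, Function.Surjective θ :=
    ⟨_, Function.invFun_surjective (f := fun q : ℕ × ℕ => fun n => decide (n = Nat.pair q.1 q.2))
      fun q q' h => by
        have := congrFun h (Nat.pair q.1 q.2)
        simpa [Nat.pair_eq_pair, Prod.ext_iff] using this⟩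
  let F : (ℕ → Bool) → exampleShift := fun γ => scrambled (θ γ).1 (θ γ).2 γ
  have hF : ∀ γ γ', γ ≠ γ' → IsStrongLiYorkePair exampleMap (F γ) (F γ') :=
    fun γ γ' h => isStrongLiYorkePair_scrambled _ _ _ _ h
  have hinj : Function.Injective F := fun γ γ' h => by
    by_contra hne
    refine (hF γ γ' hne).1.2 ?_
    rw [h]
    exact tendsto_diag_uniformity _ _
  refine ⟨Set.range F, fun hc => ?_, fun a => mem_closure_iff_nhds.2 fun U hU => ?_, ?_⟩
  · have : Countable (ℕ → Bool) := by
      have := hc.to_subtype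
      exact (Set.rangeFactorization_injective.2 hinj).countable
    have h1 : Cardinal.mk (ℕ → Bool) ≤ Cardinal.aleph0 := Cardinal.mk_le_aleph0
    exact h1.not_gt (hcard ▸ Cardinal.aleph0_lt_continuum)
  · obtain ⟨i, m, -, -, hi⟩ := exists_word_of_mem_nhds hU 0
    obtain ⟨γ, hγ⟩ := hθ (i, m)
    refine ⟨F γ, hi _ fun t ht => ?_, γ, rfl⟩
    simp only [F, hγ]
    exact scrambled_agree i m γ ht
  · rintro _ ⟨γ, rfl⟩ _ ⟨γ', rfl⟩ hne
    exact hF γ γ' fun h => hne (by rw [h])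

end EvenCty

theorem mainTheorem2 :
    ∃ (hX : EvenCty.IsSubshift EvenCty.exampleShift)
      (hx : EvenCty.pointX ∈ EvenCty.exampleShift)
      (h0 : EvenCty.zeroSeq ∈ EvenCty.exampleShift),
      IsCompact EvenCty.exampleShift ∧
      EvenCty.IsTransitive hX.map ∧
      EvenCty.IsNontrivialEvenContinuityPair hX.map
        ⟨EvenCty.pointX, hx⟩ ⟨EvenCty.zeroSeq, h0⟩ ∧
      (∀ a, ¬ EvenCty.IsEvenContinuityPoint hX.map a) ∧
      (∀ a b, ¬ EvenCty.IsEquicontinuityPair hX.map a b) ∧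
      EvenCty.IsAuslanderYorkeChaotic hX.map ∧
      EvenCty.IsDenselyLiYorkeChaotic hX.map ∧
      EvenCty.IsStronglyLiYorkeChaotic hX.map ∧
      ¬ EvenCty.IsDevaneyChaotic hX.map := by
  obtain ⟨S, hS, hSd, hSp⟩ := EvenCty.exists_strongly_scrambled
  exact ⟨EvenCty.isSubshift_exampleShift, EvenCty.pointX_mem, EvenCty.zeroSeq_mem,
    EvenCty.isSubshift_exampleShift.isClosed.isCompact, EvenCty.isTransitive_exampleMap,
    EvenCty.isNontrivialEvenContinuityPair, EvenCty.not_isEvenContinuityPoint,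
    EvenCty.not_isEquicontinuityPair,
    ⟨EvenCty.isTransitive_exampleMap, EvenCty.isSensitive_exampleMap⟩,
    ⟨S, hS, hSd, hSp.mono' fun _ _ h => h.1⟩, ⟨S, hS, hSp⟩,
    fun h => EvenCty.not_dense_periodicPts h.2.2⟩
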